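/- For a cardinal $\mu$ and a simple undirected graph $X=(V,E)$, let $\mathrm{Col}(X,\mu)$ say that $X$ has coloring number at most $\mu$, i.e. that there is a well-order $\prec$ of $V$ such that for every $v\in V$ the set $\{w\in V : w\prec v,\ \{v,w\}\in E\}$ has size $<\mu$. For an uncountable regular cardinal $\kappa$, let $\mathrm{SList}(X,\kappa)$ say that for every function $L$ assigning to each vertex $v\in V$ a stationary subset $L(v)$ of $\kappa$ there is a function $c:V\to\kappa$ with $c(v)\in L(v)$ for all $v\in V$ and $c(v)\neq c(w)$ whenever $\{v,w\}\in E$. For a regular cardinal $\lambda$, let $I[\lambda]$ be the set of all $S\subseteq\lambda$ for which there are a sequence $\langle b_\xi:\xi<\lambda\rangle$ of bounded subsets of $\lambda$ and a club $C\subseteq\lambda$ such that for every $\gamma\in C\cap S$ there is a set $c_\gamma\subseteq\gamma$, cofinal in $\gamma$ and of order type $\mathrm{cf}(\gamma)$, such that for every $\delta<\gamma$ there is $\eta<\gamma$ with $c_\gamma\cap\delta=b_\eta$. **Theorem.** Assume $\mathrm{GCH}$. Let $\kappa$ be an uncountable regular cardinal and let $X$ be a graph such that $\mathrm{SList}(X,\kappa)$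 holds. Then: 1. $\mathrm{Col}(X,\kappa^{++})$ holds; 2. if moreover $\lambda\in I[\lambda]$ for every (infinite) regular cardinal $\lambda$, then $\mathrm{Col}(X,\kappa^{+})$ holds. -/

import Mathlib

open Cardinal Order

universe u

/-- The generalized continuum hypothesis: `2 ^ μ = μ⁺` for every infinite cardinal `μ`. -/
def GCH : Prop :=
  ∀ μ : Cardinal.{u}, ℵ₀ ≤ μ → (2 : Cardinal.{u}) ^ μ = succ μ

namespace SimpleGraph

variable {V : Type u}

/-- A function `c` on the vertices is good if adjacent vertices get different values. -/
def IsGood (X : SimpleGraph V) {K : Type*} (c : V → K) : Prop :=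
  ∀ v w : V, X.Adj v w → c v ≠ c w

/-- `Col(X, μ)`: there is a well-order `r` of the vertices such that every vertex has fewer than
`μ` neighbours below it. That is, the coloring number of `X` is at most `μ`. -/
def Col (X : SimpleGraph V) (μ : Cardinal.{u}) : Prop :=
  ∃ r : V → V → Prop, IsWellOrder V r ∧ ∀ v : V, #{w : V | r w v ∧ X.Adj v w} < μ

/-- `SList(X, κ)`: for every assignment `L` of stationary subsets of `κ` to the vertices, there is
a choice function of `L` that is a good coloring. The cardinal `κ` is represented by the
well-ordered type `κ.ord.ToType` of order type `κ.ord`. -/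
def SList (X : SimpleGraph V) (κ : Cardinal.{u}) : Prop :=
  ∀ L : V → Set κ.ord.ToType, (∀ v, IsStationary (L v)) →
    ∃ c : V → κ.ord.ToType, (∀ v, c v ∈ L v) ∧ X.IsGood c

end SimpleGraph

/-- The approachability ideal `I[μ]`, as a family of subsets of the well-ordered type
`μ.ord.ToType` of order type `μ.ord`. A point `γ` of this type plays the role of the ordinal
`Set.Iio γ`; so `Order.cof (Set.Iio γ)` is `cf γ`, and the third clause on `c` reads
`otp c = cf γ`. -/
def approachabilityIdeal (μ : Cardinal.{u}) : Set (Set μ.ord.ToType) :=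
  {S | ∃ (b : μ.ord.ToType → Set μ.ord.ToType) (C : Set μ.ord.ToType),
    IsClub C ∧ (∀ ξ, BddAbove (b ξ)) ∧
    ∀ γ ∈ C ∩ S, ∃ c : Set μ.ord.ToType,
      c ⊆ Set.Iio γ ∧
      (∀ x < γ, ∃ y ∈ c, x ≤ y) ∧
      Ordinal.type (fun x y : c => x < y) = (Order.cof (Set.Iio γ)).ord ∧
      ∀ δ < γ, ∃ η < γ, c ∩ Set.Iio δ = b η}

/-! Stationary lists enter only through `SList.sparseSubsets`: every set of κ⁺ vertices has a subset
of size ≤ κ with at most κ⁺ common neighbors. If this fails for A, let the lists on A run through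
all 2^κ = κ⁺ stationary sets, so that A receives a stationary set of colors in any coloring; some
common neighbor of a ≤ κ-sized transversal then has exactly that color set as its list and cannot be
colored.

The rest is induction on |V|: write V as an increasing chain of smaller sets U i such that a vertex
outside them has few neighbors in the union of the earlier ones. Closing under common neighbors of
sparse subsets does this (`Col.of_power_lt`) unless |V| = θ⁺ with cf θ ≤ κ. In that case closing a
set of size θ may enlarge it, so only ≤ κ pieces of size < θ are treated. Each U i then leaves ≤ κ
neighbors, but at limits of cofinality κ⁺ these may add up to κ⁺, whence κ⁺⁺; approachability
excludes such limits. -/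

theorem Cardinal.mk_iUnion_le_of_le {ι α : Type u} {ν : Cardinal.{u}} (hν : ℵ₀ ≤ ν)
    (hι : #ι ≤ ν) (f : ι → Set α) (hf : ∀ i, #(f i) ≤ ν) : #(⋃ i, f i) ≤ ν :=
  calc #(⋃ i, f i) ≤ Cardinal.sum fun i => #(f i) := mk_iUnion_le_sum_mk
    _ ≤ Cardinal.sum fun _ : ι => ν := sum_le_sum _ _ hf
    _ = #ι * ν := by simp
    _ ≤ ν * ν := by gcongr
    _ = ν := mul_eq_self hν

theorem Cardinal.mk_union_le_of_le {α : Type u} {ν : Cardinal.{u}} (hν : ℵ₀ ≤ ν)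
    {s t : Set α} (hs : #s ≤ ν) (ht : #t ≤ ν) : #(s ∪ t : Set α) ≤ ν :=
  (mk_union_le s t).trans (add_le_of_le hν hs ht)

theorem Cardinal.mk_Iio_ord_toType_lt {c : Cardinal.{u}} (i : c.ord.ToType) :
    #(Set.Iio i) < c := by
  simpa using mk_Iio_lt i (by simp)

/-! ### Cardinal exponentiation under GCH. -/

namespace GCH

theorem power_le_succ (gch : GCH.{u}) {κ ν : Cardinal.{u}} (hν : ℵ₀ ≤ ν) (h : κ ≤ ν) :
    ν ^ κ ≤ succ ν := by
  have h0 : ν ≠ 0 := (aleph0_pos.trans_le hν).ne'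
  calc ν ^ κ ≤ ν ^ ν := power_le_power_left h0 h
    _ = 2 ^ ν := power_self_eq hν
    _ = succ ν := gch ν hν

theorem succ_power_self (gch : GCH.{u}) {κ : Cardinal.{u}} (hκ : ℵ₀ ≤ κ) :
    succ κ ^ κ = succ κ := by
  rw [← gch κ hκ, ← power_mul, mul_eq_self hκ]

theorem power_le_of_lt (gch : GCH.{u}) {κ ν θ : Cardinal.{u}} (hκ : ℵ₀ ≤ κ) (hκθ : κ < θ)
    (hν : ν < θ) : ν ^ κ ≤ θ :=
  calc ν ^ κ ≤ max ν κ ^ κ := power_le_power_right (le_max_left _ _)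
    _ ≤ succ (max ν κ) := gch.power_le_succ (hκ.trans (le_max_right _ _)) (le_max_right _ _)
    _ ≤ θ := succ_le_of_lt (max_lt hν hκθ)

/-- Every function from κ to θ is bounded, so θ ^ κ is a union of θ sets of functions into proper
initial segments. -/
theorem power_le_of_lt_cof (gch : GCH.{u}) {κ θ : Cardinal.{u}} (hκ : ℵ₀ ≤ κ)
    (hθ : κ < θ.ord.cof) : θ ^ κ ≤ θ := by
  have hκθ : κ < θ := hθ.trans_le (Ordinal.cof_ord_le θ)
  have hθ0 : ℵ₀ ≤ θ := hκ.trans hκθ.le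
  have : NoMaxOrder θ.ord.ToType := Cardinal.noMaxOrder hθ0
  let F : θ.ord.ToType → Set (κ.out → θ.ord.ToType) := fun t => {f | ∀ k, f k < t}
  have hF : (⋃ t, F t) = Set.univ := by
    refine Set.eq_univ_of_forall fun f => ?_
    have : ¬ IsCofinal (Set.range f) := fun h => by
      have h1 := (cof_le h).trans mk_range_le
      rw [Ordinal.cof_toType, mk_out] at h1
      exact h1.not_gt hθ
    rw [not_isCofinal_iff] at this
    obtain ⟨t, ht⟩ := this
    exact Set.mem_iUnion.2 ⟨t, fun k => ht _ ⟨k, rfl⟩⟩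
  have hc : #(κ.out → θ.ord.ToType) = θ ^ κ := by simp
  rw [← hc, ← mk_univ, ← hF]
  refine mk_iUnion_le_of_le hθ0 (by simp) _ fun t => ?_
  have : #(F t) ≤ #(κ.out → Set.Iio t) :=
    mk_le_of_injective (f := fun f k => ⟨f.1 k, f.2 k⟩) fun f g h => by
      ext k
      exact congrArg Subtype.val (congrFun h k)
  refine this.trans ?_
  have h2 : #(κ.out → Set.Iio t) = #(Set.Iio t) ^ κ := by simp
  rw [h2]
  refine gch.power_le_of_lt hκ hκθ ?_
  exact mk_Iio_ord_toType_lt t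

end GCH

theorem exists_injective_choice {P V : Type u} (B : P → Set V) (h : ∀ p, #P < #(B p)) :
    ∃ f : P → V, Function.Injective f ∧ ∀ p, f p ∈ B p := by
  classical
  let r : P → P → Prop := WellOrderingRel
  have key : ∀ (p : P) (g : P → V), ∃ v ∈ B p, ∀ q, g q ≠ v := by
    intro p g
    by_contra! hc
    have : #(B p) ≤ #(Set.range g) := mk_le_mk_of_subset fun v hv => hc v hv
    exact (this.trans mk_range_le).not_gt (h p)
  have key' : ∀ (p : P) (g : ∀ q, r q p → V), ∃ v ∈ B p, ∀ q hq, g q hq ≠ v := by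
    intro p g
    obtain ⟨v0, hv0, -⟩ : ∃ v ∈ B p, True := by
      have : #(B p) ≠ 0 := ((zero_le (a := #P)).trans_lt (h p)).ne'
      obtain ⟨v⟩ := mk_ne_zero_iff.1 this
      exact ⟨v, v.2, trivial⟩
    obtain ⟨v, hv, hv'⟩ := key p fun q => if hq : r q p then g q hq else v0
    refine ⟨v, hv, fun q hq => ?_⟩
    simpa [hq] using hv' q
  choose s hs hs' using key'
  let f : P → V := IsWellFounded.fix r s
  have hf : ∀ p, f p = s p fun q _ => f q := fun p => IsWellFounded.fix_eq r s p
  have hne : ∀ p q, r q p → f q ≠ f p := fun p q hq => by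
    rw [hf p]
    exact hs' p (fun q _ => f q) q hq
  refine ⟨f, fun p q hpq => ?_, fun p => by rw [hf p]; exact hs _ _⟩
  rcases trichotomous_of r p q with h | h | h
  · exact absurd hpq (hne _ _ h)
  · exact h
  · exact absurd hpq.symm (hne _ _ h)

/-! ### From stationary lists to sparse subsets. -/

namespace SimpleGraph

variable {V : Type u}

/-- The set of vertices that are adjacent to all elements of `y`. -/
def commonNbrs (X : SimpleGraph V) (y : Set V) : Set V := {v | ∀ w ∈ y, X.Adj v w}

/-- A set of at most `κ` vertices is sparse if it has at most `κ⁺` common neighbors. -/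
def IsSparse (X : SimpleGraph V) (κ : Cardinal.{u}) (y : Set V) : Prop :=
  #y ≤ κ ∧ #(X.commonNbrs y) ≤ succ κ

/-- Every set of at least `κ⁺` vertices contains a sparse subset. -/
def SparseSubsets (X : SimpleGraph V) (κ : Cardinal.{u}) : Prop :=
  ∀ A : Set V, succ κ ≤ #A → ∃ y ⊆ A, X.IsSparse κ y

theorem SList.sparseSubsets (gch : GCH.{u}) {κ : Cardinal.{u}} (hκ : κ.IsRegular) (hκ' : ℵ₀ < κ)
    {X : SimpleGraph V} (hX : X.SList κ) : X.SparseSubsets κ := by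
  classical
  intro A' hA'
  obtain ⟨A, hAA, hA⟩ := le_mk_iff_exists_subset.1 hA'
  by_contra! hc
  replace hc : ∀ y ⊆ A, #y ≤ κ → succ κ < #(X.commonNbrs y) := fun y hy hyκ =>
    not_le.1 fun h => hc y (hy.trans hAA) ⟨hyκ, h⟩
  have hsκ : ℵ₀ ≤ succ κ := hκ'.le.trans (le_succ κ)
  have : Nonempty κ.ord.ToType := by
    rw [← mk_ne_zero_iff]; simpa using (aleph0_pos.trans hκ').ne'
  have hcof : cof κ.ord.ToType ≠ ℵ₀ := by
    rw [Ordinal.cof_toType, hκ.cof_ord]; exact hκ'.ne'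
  let St := {L : Set κ.ord.ToType // IsStationary L}
  have hSt : #St ≤ succ κ := by
    refine (mk_subtype_le _).trans ?_
    rw [mk_set, mk_ord_toType, gch κ hκ'.le]
  let Y := {y : Set V // y ⊆ A ∧ #y ≤ κ}
  have hY : #Y ≤ succ κ := by
    refine (mk_bounded_subset_le A κ).trans ?_
    rw [hA, max_eq_left hsκ, gch.succ_power_self hκ'.le]
  have hP : #(Y × St) ≤ succ κ := by
    rw [mk_prod, lift_id, lift_id]
    exact (mul_le_mul' hY hSt).trans (mul_eq_self hsκ).le
  obtain ⟨f, hf, hf'⟩ := exists_injective_choice (P := Y × St)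
      (fun p => X.commonNbrs p.1.1 \ A) fun p => by
    by_contra! h
    have h1 : #(X.commonNbrs p.1.1) ≤ succ κ := by
      refine (mk_le_mk_of_subset (t := (X.commonNbrs p.1.1 \ A) ∪ A) ?_).trans
        (mk_union_le_of_le hsκ (h.trans hP) hA.le)
      intro v hv
      by_cases hvA : v ∈ A
      · exact Or.inr hvA
      · exact Or.inl ⟨hv, hvA⟩
    exact h1.not_gt (hc _ p.1.2.1 p.1.2.2)
  let univSt : St := ⟨Set.univ, IsStationary.univ⟩
  have : Nonempty St := ⟨univSt⟩
  obtain ⟨e, he⟩ : ∃ e : A → St, Function.Surjective e := by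
    obtain ⟨i⟩ := (hSt.trans hA.ge : #St ≤ #A)
    exact ⟨_, Function.invFun_surjective i.injective⟩
  -- Consistent because `f` is injective and avoids A; vertices outside A and the range of `f` are
  -- irrelevant.
  let L : V → St := fun v =>
    if hv : v ∈ A then e ⟨v, hv⟩ else if h : ∃ p, f p = v then h.choose.2 else univSt
  have hLf : ∀ p, L (f p) = p.2 := fun p => by
    have h : ∃ q, f q = f p := ⟨p, rfl⟩
    have h1 : L (f p) = h.choose.2 := by
      simp only [L, dif_neg (hf' p).2, dif_pos h]
    rw [h1, hf h.choose_spec]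
  obtain ⟨c, hcL, hcX⟩ := hX (fun v => (L v).1) fun v => (L v).2
  -- Since cf κ ≠ ω, a club D is itself stationary, hence the list of some a in A.
  have hcA : IsStationary (c '' A) := fun D hD => by
    obtain ⟨⟨a, ha⟩, hae⟩ := he ⟨D, hD.isStationary hcof⟩
    refine ⟨c a, ⟨a, ha, rfl⟩, ?_⟩
    have h1 := hcL a
    simp only [L, dif_pos ha, hae] at h1
    exact h1
  obtain ⟨y, hyA, hyc⟩ := Set.exists_subset_bijOn A c
  have hyκ : #y ≤ κ := by
    rw [← mk_image_eq_of_injOn _ _ hyc.injOn]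
    exact (mk_set_le _).trans (by simp)
  let p : Y × St := ⟨⟨y, hyA, hyκ⟩, ⟨_, hcA⟩⟩
  have h1 := hcL (f p)
  rw [hLf p] at h1
  replace h1 : c (f p) ∈ c '' A := h1
  rw [← hyc.image_eq] at h1
  obtain ⟨w, hw, hwc⟩ := h1
  exact hcX (f p) w ((hf' p).1 w hw) hwc.symm

end SimpleGraph

/-! ### Increasing chains and closure under sparse hulls. -/

/-- If ν indices were cofinal in K, then N would be a union of ν sets of size ≤ ν. -/
theorem exists_forall_lt_of_mk_inter_le {I V : Type u} [LinearOrder I] {U : I → Set V}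
    (hU : Monotone U) {K : Set I} {N : Set V} {ν : Cardinal.{u}} (hν : ℵ₀ ≤ ν)
    (hNK : ∀ w ∈ N, ∃ k ∈ K, w ∈ U k) (hN : ∀ k ∈ K, #(N ∩ U k : Set V) ≤ ν) (hνN : ν < #N)
    {ι : Type u} (hι : #ι ≤ ν) (f : ι → I) (hf : ∀ a, f a ∈ K) : ∃ x ∈ K, ∀ a, f a < x := by
  by_contra! h
  refine hνN.not_ge ((mk_le_mk_of_subset fun w hw => ?_).trans
    (mk_iUnion_le_of_le hν hι (fun a => N ∩ U (f a)) fun a => hN _ (hf a)))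
  obtain ⟨k, hk, hwk⟩ := hNK w hw
  obtain ⟨a, ha⟩ := h k hk
  exact Set.mem_iUnion.2 ⟨a, hw, hU ha hwk⟩

theorem mk_le_succ_of_mk_inter_le {I V : Type u} [LinearOrder I] {U : I → Set V}
    (hU : Monotone U) {K : Set I} {N : Set V} {ν : Cardinal.{u}} (hν : ℵ₀ ≤ ν)
    (hNK : ∀ w ∈ N, ∃ k ∈ K, w ∈ U k) (hN : ∀ k ∈ K, #(N ∩ U k : Set V) ≤ ν) : #N ≤ succ ν := by
  by_contra! h
  obtain ⟨N', hN', hcard⟩ := le_mk_iff_exists_subset.1 h.le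
  choose f hf hfU using fun w : N' => hNK w (hN' w.2)
  obtain ⟨x, hx, hfx⟩ := exists_forall_lt_of_mk_inter_le hU (hν.trans (le_succ ν)) hNK
    (fun k hk => (hN k hk).trans (le_succ ν)) h hcard.le f hf
  have h1 : #N' ≤ #(N ∩ U x : Set V) :=
    mk_le_mk_of_subset fun w hw => ⟨hN' hw, hU (hfx ⟨w, hw⟩).le (hfU ⟨w, hw⟩)⟩
  rw [hcard] at h1
  exact (lt_succ ν).not_ge (h1.trans (hN x hx))

namespace SimpleGraph

variable {V : Type u} {X : SimpleGraph V} {κ μ : Cardinal.{u}}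

/-- Order lexicographically, by rank and then within each fiber. -/
theorem Col.of_rank (hμ : ℵ₀ ≤ μ) {I : Type u} [LinearOrder I] [WellFoundedLT I] (ρ : V → I)
    (hfib : ∀ i, (X.induce (ρ ⁻¹' {i})).Col μ)
    (hlow : ∀ v, #{w : V | ρ w < ρ v ∧ X.Adj v w} < μ) : X.Col μ := by
  choose r hr hrμ using hfib
  let g : V → Ordinal.{u} := fun v => Ordinal.typein (r (ρ v)) ⟨v, rfl⟩
  have hg : ∀ i v (h : ρ v = i), g v = Ordinal.typein (r i) ⟨v, h⟩ := by
    rintro _ v rfl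
    rfl
  let F : V → I ×ₗ Ordinal.{u} := fun v => toLex (ρ v, g v)
  have hF : Function.Injective F := fun v w h => by
    have h1 : ρ v = ρ w := congrArg (fun p => (ofLex p).1) h
    have h2 : g v = g w := congrArg (fun p => (ofLex p).2) h
    rw [hg _ v h1, hg _ w rfl] at h2
    exact congrArg Subtype.val (Ordinal.typein_injective _ h2)
  refine ⟨fun v w => F v < F w,
    (RelEmbedding.preimage ⟨F, hF⟩ (· < ·) : (_ ↪r _)).isWellOrder, fun v => ?_⟩
  have hsub : {w | F w < F v ∧ X.Adj v w} ⊆ {w | ρ w < ρ v ∧ X.Adj v w} ∪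
      Subtype.val '' {w : ρ ⁻¹' {ρ v} | r (ρ v) w ⟨v, rfl⟩ ∧
        (X.induce (ρ ⁻¹' {ρ v})).Adj ⟨v, rfl⟩ w} := by
    rintro w ⟨hw, hvw⟩
    rcases Prod.Lex.toLex_lt_toLex.1 hw with h | ⟨h1, h2⟩
    · exact Or.inl ⟨h, hvw⟩
    · refine Or.inr ⟨⟨w, h1⟩, ⟨?_, hvw⟩, rfl⟩
      replace h2 : g w < g v := h2
      rw [hg _ w h1, hg _ v rfl] at h2
      exact (Ordinal.typein_lt_typein _).1 h2
  refine (mk_le_mk_of_subset hsub).trans_lt ((mk_union_le _ _).trans_lt ?_)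
  exact add_lt_of_lt hμ (hlow v) (mk_image_le.trans_lt (hrμ _ _))

theorem Col.of_cover (hμ : ℵ₀ ≤ μ) {I : Type u} [LinearOrder I] [WellFoundedLT I] (U : I → Set V)
    (hcov : ∀ v, ∃ i, v ∈ U i) (hcol : ∀ i, ∀ s ⊆ U i, (X.induce s).Col μ)
    (hlow : ∀ i v, (∀ j < i, v ∉ U j) →
      #{w : V | (∃ j < i, w ∈ U j) ∧ X.Adj v w} < μ) : X.Col μ := by
  have hwf : WellFounded ((· < ·) : I → I → Prop) := wellFounded_lt
  let ρ : V → I := fun v => hwf.min {i | v ∈ U i} (hcov v)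
  have hρ : ∀ v, v ∈ U (ρ v) := fun v => hwf.min_mem {i | v ∈ U i} (hcov v)
  refine Col.of_rank hμ ρ (fun i => hcol i _ ?_) fun v => ?_
  · rintro v rfl
    exact hρ v
  · refine (mk_le_mk_of_subset ?_).trans_lt
      (hlow (ρ v) v fun j hj hv => hwf.not_lt_min {i | v ∈ U i} hv hj)
    rintro w ⟨hw, hvw⟩
    exact ⟨⟨_, hw, hρ w⟩, hvw⟩

theorem Col.of_mk_le (h : #V ≤ μ) : X.Col μ := by
  obtain ⟨r, hr, hrV⟩ := exists_ord_eq V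
  refine ⟨r, hr, fun v => ?_⟩
  have h1 : #{w : V | r w v} < #V := by
    have := Ordinal.typein_lt_type r v
    rw [← hrV, Cardinal.lt_ord] at this
    exact this
  exact (mk_le_mk_of_subset fun w hw => hw.1).trans_lt (h1.trans_le h)

/-- The union of the sets of common neighbors of the sparse subsets of `P`. -/
def sparseHull (X : SimpleGraph V) (κ : Cardinal.{u}) (P : Set V) : Set V :=
  ⋃ y : {y : Set V // y ⊆ P ∧ X.IsSparse κ y}, X.commonNbrs y.1

/-- Every vertex outside `W` has at most `κ` neighbors in `W`. -/
def FewNbrs (X : SimpleGraph V) (κ : Cardinal.{u}) (W : Set V) : Prop :=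
  ∀ v ∉ W, #(W ∩ X.neighborSet v : Set V) ≤ κ

theorem IsSparse.subset_sparseHull {P y : Set V} (hy : X.IsSparse κ y) (h : y ⊆ P) :
    X.commonNbrs y ⊆ X.sparseHull κ P :=
  Set.subset_iUnion (fun y : {y : Set V // y ⊆ P ∧ X.IsSparse κ y} => X.commonNbrs y.1)
    ⟨y, h, hy⟩

theorem sparseHull_mono {P Q : Set V} (h : P ⊆ Q) : X.sparseHull κ P ⊆ X.sparseHull κ Q :=
  Set.iUnion_subset fun y => y.2.2.subset_sparseHull (y.2.1.trans h)

theorem mk_sparseHull_le {P : Set V} {ν : Cardinal.{u}} (hκν : ℵ₀ ≤ κ) (hν : succ κ ≤ ν)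
    (hP : max #P ℵ₀ ^ κ ≤ ν) : #(X.sparseHull κ P) ≤ ν := by
  refine mk_iUnion_le_of_le ((hκν.trans (le_succ κ)).trans hν) ?_ _ fun y => y.2.2.2.trans hν
  refine (mk_subtype_mono fun y hy => ?_).trans ((mk_bounded_subset_le P κ).trans hP)
  exact ⟨hy.1, hy.2.1⟩

theorem SparseSubsets.mem_of_lt (hX : X.SparseSubsets κ) {P T N : Set V} {v : V}
    (hPT : X.sparseHull κ P ⊆ T) (hNP : N ⊆ P) (hN : κ < #N) (hNv : N ⊆ X.neighborSet v) :
    v ∈ T := by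
  obtain ⟨y, hy, hys⟩ := hX N (succ_le_of_lt hN)
  exact hPT (hys.subset_sparseHull (hy.trans hNP) fun w hw => hNv (hy hw))

theorem SparseSubsets.mk_inter_le (hX : X.SparseSubsets κ) {P T : Set V}
    (hPT : X.sparseHull κ P ⊆ T) {v : V} (hv : v ∉ T) :
    #(P ∩ X.neighborSet v : Set V) ≤ κ := by
  by_contra! h
  exact hv (hX.mem_of_lt hPT Set.inter_subset_left h Set.inter_subset_right)

theorem SparseSubsets.induce (hX : X.SparseSubsets κ) (s : Set V) :
    (X.induce s).SparseSubsets κ := by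
  intro A hA
  obtain ⟨y, hyA, hyκ, hyc⟩ := hX (Subtype.val '' A)
    (by rwa [mk_image_eq Subtype.val_injective])
  refine ⟨Subtype.val ⁻¹' y, fun w hw => ?_, ?_, ?_⟩
  · obtain ⟨w', hw', h⟩ := hyA hw
    rwa [← Subtype.val_injective h]
  · exact (mk_preimage_of_injective _ _ Subtype.val_injective).trans hyκ
  · refine le_trans ?_ hyc
    rw [← mk_image_eq (s := (X.induce s).commonNbrs _) Subtype.val_injective]
    refine mk_le_mk_of_subset ?_
    rintro _ ⟨v, hv, rfl⟩ w hw
    obtain ⟨w', -, rfl⟩ := hyA hw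
    exact hv w' hw

/-- Iterate the hull κ⁺ times: by regularity, a subset of size ≤ κ already lies in some stage. -/
theorem exists_sparseHull_subset (hκ : ℵ₀ ≤ κ) {ν : Cardinal.{u}} (hκν : succ κ ≤ ν)
    (hν : ν ^ κ ≤ ν) (W : Set V) (hW : #W ≤ ν) :
    ∃ T, W ⊆ T ∧ X.sparseHull κ T ⊆ T ∧ #T ≤ ν := by
  have hsκ : ℵ₀ ≤ succ κ := hκ.trans (le_succ κ)
  have hν0 : ℵ₀ ≤ ν := hsκ.trans hκν
  let I := (succ κ).ord.ToType
  have : NoMaxOrder I := Cardinal.noMaxOrder hsκ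
  let G : (i : I) → (∀ j, j < i → Set V) → Set V := fun i IH =>
    W ∪ ⋃ j : Set.Iio i, (IH j.1 j.2 ∪ X.sparseHull κ (IH j.1 j.2))
  let T : I → Set V := IsWellFounded.fix (· < ·) G
  have hT : ∀ i, T i = W ∪ ⋃ j : Set.Iio i, (T j ∪ X.sparseHull κ (T j)) :=
    fun i => IsWellFounded.fix_eq (· < ·) G i
  have hTlt : ∀ i j, j < i → T j ∪ X.sparseHull κ (T j) ⊆ T i := fun i j hj => by
    rw [hT i]
    exact (Set.subset_iUnion (fun j : Set.Iio i => T j ∪ X.sparseHull κ (T j)) ⟨j, hj⟩).trans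
      Set.subset_union_right
  have hTcard : ∀ i, #(T i) ≤ ν := fun i => by
    induction i using WellFoundedLT.induction with
    | ind i IH =>
      rw [hT i]
      refine mk_union_le_of_le hν0 hW (mk_iUnion_le_of_le hν0 ?_ _ fun j => ?_)
      · exact (mk_Iio_ord_toType_lt i).le.trans hκν
      · refine mk_union_le_of_le hν0 (IH j j.2) (mk_sparseHull_le hκ hκν ?_)
        exact (power_le_power_right (max_le (IH j j.2) hν0)).trans hν
  have hne : Nonempty I := by
    rw [← mk_ne_zero_iff]; simp [I]
  refine ⟨⋃ i, T i, ?_, ?_, mk_iUnion_le_of_le hν0 (by simpa [I] using hκν) _ hTcard⟩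
  · obtain ⟨i⟩ := hne
    refine Set.Subset.trans ?_ (Set.subset_iUnion T i)
    rw [hT i]
    exact Set.subset_union_left
  · refine Set.iUnion_subset fun y => ?_
    choose f hf using fun w : y.1 => Set.mem_iUnion.1 (y.2.1 w.2)
    have hb : ¬ IsCofinal (Set.range f) := fun h => by
      have h1 := ((cof_le h).trans mk_range_le).trans y.2.2.1
      rw [Ordinal.cof_toType, (isRegular_succ hκ).cof_ord] at h1
      exact (lt_succ κ).not_ge h1
    obtain ⟨t, ht⟩ := not_isCofinal_iff.1 hb
    obtain ⟨t', ht'⟩ := exists_gt t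
    have hyt : y.1 ⊆ T t := fun w hw =>
      hTlt t _ (ht _ ⟨⟨w, hw⟩, rfl⟩) (Or.inl (hf ⟨w, hw⟩))
    have h2 : X.commonNbrs y.1 ⊆ X.sparseHull κ (T t) := y.2.2.subset_sparseHull hyt
    exact (h2.trans (Set.subset_union_right.trans (hTlt t' t ht'))).trans
      (Set.subset_iUnion T t')

theorem Col.of_power_lt (hκ : ℵ₀ ≤ κ) (hμ : succ κ ≤ μ) (hX : X.SparseSubsets κ) (hV : μ < #V)
    (hpow : ∀ ν < #V, ν ^ κ < #V) (hcol : ∀ s : Set V, #s < #V → (X.induce s).Col μ) :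
    X.Col μ := by
  have hsκ : ℵ₀ ≤ succ κ := hκ.trans (le_succ κ)
  have hV0 : ℵ₀ ≤ #V := (hsκ.trans hμ).trans hV.le
  let I := (#V).ord.ToType
  have : NoMaxOrder I := Cardinal.noMaxOrder hV0
  obtain ⟨e⟩ : Nonempty (V ≃ I) := by
    rw [← Cardinal.eq]; simp [I]
  -- The least closed superset, because the chain must be monotone.
  let cl : Set V → Set V := fun S => ⋂₀ {T | S ⊆ T ∧ X.sparseHull κ T ⊆ T}
  have hclmono : Monotone cl := fun S S' h => Set.subset_sInter fun T hT =>
    Set.sInter_subset_of_mem ⟨h.trans hT.1, hT.2⟩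
  have hclsub : ∀ S, S ⊆ cl S := fun S => Set.subset_sInter fun T hT => hT.1
  have hclcl : ∀ S, X.sparseHull κ (cl S) ⊆ cl S := fun S => Set.subset_sInter fun T hT =>
    (sparseHull_mono (Set.sInter_subset_of_mem hT)).trans hT.2
  have hclle : ∀ S T, S ⊆ T → X.sparseHull κ T ⊆ T → cl S ⊆ T := fun S T h h' =>
    Set.sInter_subset_of_mem ⟨h, h'⟩
  have hclcard : ∀ S : Set V, #S < #V → #(cl S) < #V := fun S hS => by
    have hm : max #S (succ κ) < #V := max_lt hS (hμ.trans_lt hV)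
    have h1 : max #S (succ κ) ≤ max #S (succ κ) ^ κ :=
      self_le_power _ (one_le_aleph0.trans hκ)
    obtain ⟨T, hST, hT, hTc⟩ := exists_sparseHull_subset (X := X) hκ
      ((le_max_right #S (succ κ)).trans h1)
      (by rw [← power_mul, mul_eq_self hκ]) S ((le_max_left _ _).trans h1)
    exact ((mk_le_mk_of_subset (hclle S T hST hT)).trans hTc).trans_lt
      (hpow _ hm)
  let U : I → Set V := fun i => cl (e ⁻¹' Set.Iio i)
  have hU : Monotone U := fun i j h => hclmono fun v (hv : e v < i) => hv.trans_le h
  refine Col.of_cover (hsκ.trans hμ) U (fun v => ?_) (fun i s hs => hcol s ?_) fun i v hv => ?_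
  · obtain ⟨i, hi⟩ := exists_gt (e v)
    exact ⟨i, hclsub _ hi⟩
  · refine (mk_le_mk_of_subset hs).trans_lt (hclcard _ ?_)
    exact (mk_preimage_of_injective _ _ e.injective).trans_lt (mk_Iio_ord_toType_lt i)
  · refine lt_of_lt_of_le (lt_succ_of_le ?_) hμ
    by_contra! hN
    have hNk : ∀ k ∈ Set.Iio i,
        #({w : V | (∃ j < i, w ∈ U j) ∧ X.Adj v w} ∩ U k : Set V) ≤ κ := fun k hk =>
      (mk_le_mk_of_subset (t := U k ∩ X.neighborSet v) fun w hw => ⟨hw.2, hw.1.2⟩).trans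
        (hX.mk_inter_le (hclcl _) (hv k hk))
    obtain ⟨y, hy, hys⟩ := hX _ (succ_le_of_lt hN)
    choose f hf hfU using fun w : y => (hy w.2).1
    obtain ⟨x, hx, hfx⟩ := exists_forall_lt_of_mk_inter_le hU hκ (fun w hw => hw.1) hNk hN hys.1
      f hf
    exact hv x hx (hclcl _ (hys.subset_sparseHull
      (fun w hw => hU (hfx ⟨w, hw⟩).le (hfU ⟨w, hw⟩)) fun w hw => (hy hw).2))

end SimpleGraph

/-! ### Successors of cardinals of cofinality at most κ. -/

theorem exists_pieces {κ θ : Cardinal.{u}} (hθ : ℵ₀ ≤ θ) (hcof : θ.ord.cof ≤ κ) (V : Type u) :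
    ∃ (ι : Type u) (τ : ι → Cardinal.{u}) (P : Set V → ι → Set V), #ι ≤ κ ∧ (∀ k, τ k < θ) ∧
      (∀ S k, #(P S k) ≤ τ k) ∧ ∀ S : Set V, #S ≤ θ → ∀ v ∈ S, ∃ k, v ∈ P S k := by
  have : NoMaxOrder θ.ord.ToType := Cardinal.noMaxOrder hθ
  obtain ⟨J, hJ, hJc⟩ := exists_cof_eq (α := θ.ord.ToType)
  rw [Ordinal.cof_toType] at hJc
  have key : ∀ S : Set V, ∃ Q : J → Set V, (∀ k, #(Q k) ≤ #(Set.Iio k.1)) ∧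
      (#S ≤ θ → ∀ v ∈ S, ∃ k, v ∈ Q k) := fun S => by
    by_cases hS : #S ≤ θ
    · obtain ⟨e⟩ : Nonempty (S ↪ θ.ord.ToType) := by
        rw [← Cardinal.le_def]; simpa using hS
      refine ⟨fun k => Subtype.val '' (e ⁻¹' Set.Iio k.1), fun k => ?_, fun _ v hv => ?_⟩
      · exact mk_image_le.trans (mk_preimage_of_injective _ _ e.injective)
      · obtain ⟨t, ht⟩ := exists_gt (e ⟨v, hv⟩)
        obtain ⟨k, hk, htk⟩ := hJ t
        exact ⟨⟨k, hk⟩, ⟨v, hv⟩, ht.trans_le htk, rfl⟩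
    · exact ⟨fun _ => ∅, fun _ => by simp, fun h => absurd h hS⟩
  choose P hP hP' using key
  exact ⟨J, fun k => #(Set.Iio k.1), P, hJc.le.trans hcof, fun k => mk_Iio_ord_toType_lt _, hP, hP'⟩

namespace SimpleGraph

variable {V : Type u} {X : SimpleGraph V} {κ μ θ : Cardinal.{u}}

section Pieces

variable {ι : Type u} {τ : ι → Cardinal.{u}} {P : Set V → ι → Set V}

/-- After ω rounds of adding the hulls of all pieces, the result is covered by ω · κ pieces, each
containing ≤ κ neighbors of any outside vertex. -/
theorem exists_fewNbrs (hκ : ℵ₀ ≤ κ) (hκθ : succ κ < θ) (hpow : ∀ ν < θ, ν ^ κ ≤ θ)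
    (hX : X.SparseSubsets κ) (hι : #ι ≤ κ) (hτ : ∀ k, τ k < θ) (hP : ∀ S k, #(P S k) ≤ τ k)
    (hPS : ∀ S : Set V, #S ≤ θ → ∀ v ∈ S, ∃ k, v ∈ P S k) (W : Set V) (hW : #W ≤ θ) :
    ∃ T, W ⊆ T ∧ #T ≤ θ ∧ X.FewNbrs κ T := by
  have hκθ' : κ < θ := (le_succ κ).trans_lt hκθ
  have hθ : ℵ₀ ≤ θ := hκ.trans hκθ'.le
  let T : ℕ → Set V := fun n =>
    (fun S => S ∪ ⋃ k, X.sparseHull κ (P S k))^[n] W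
  have hTs : ∀ n, T (n + 1) = T n ∪ ⋃ k, X.sparseHull κ (P (T n) k) := fun n =>
    Function.iterate_succ_apply' _ n W
  have hTc : ∀ n, #(T n) ≤ θ := fun n => by
    induction n with
    | zero => exact hW
    | succ n ih =>
      rw [hTs]
      refine mk_union_le_of_le hθ ih (mk_iUnion_le_of_le hθ (hι.trans hκθ'.le) _ fun k => ?_)
      refine mk_sparseHull_le hκ hκθ.le (hpow _ (max_lt ((hP _ k).trans_lt (hτ k)) ?_))
      exact hκ.trans_lt hκθ'
  refine ⟨⋃ n : ULift.{u} ℕ, T n.down, Set.subset_iUnion (fun n : ULift.{u} ℕ => T n.down) ⟨0⟩,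
    mk_iUnion_le_of_le hθ ((mk_le_aleph0).trans hθ) _ fun n => hTc _, fun v hv => ?_⟩
  have hsub : (⋃ n : ULift.{u} ℕ, T n.down) ∩ X.neighborSet v ⊆
      ⋃ p : ULift.{u} ℕ × ι, (P (T p.1.down) p.2 ∩ X.neighborSet v) := by
    rintro w ⟨hw, hvw⟩
    obtain ⟨n, hn⟩ := Set.mem_iUnion.1 hw
    obtain ⟨k, hk⟩ := hPS _ (hTc _) w hn
    exact Set.mem_iUnion.2 ⟨(n, k), hk, hvw⟩
  refine (mk_le_mk_of_subset hsub).trans (mk_iUnion_le_of_le hκ ?_ _ fun p => ?_)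
  · rw [mk_prod, lift_id, lift_id]
    exact (mul_le_mul' (mk_le_aleph0.trans hκ) hι).trans (mul_eq_self hκ).le
  · refine hX.mk_inter_le (T := T (p.1.down + 1)) ?_ fun h =>
      hv (Set.mem_iUnion.2 ⟨⟨p.1.down + 1⟩, h⟩)
    rw [hTs]
    exact (Set.subset_iUnion (fun k => X.sparseHull κ (P (T p.1.down) k)) p.2).trans
      Set.subset_union_right

theorem exists_chain (hκ : ℵ₀ ≤ κ) (hκθ : succ κ < θ) (hpow : ∀ ν < θ, ν ^ κ ≤ θ)
    (hX : X.SparseSubsets κ) (hι : #ι ≤ κ) (hτ : ∀ k, τ k < θ) (hP : ∀ S k, #(P S k) ≤ τ k)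
    (hPS : ∀ S : Set V, #S ≤ θ → ∀ v ∈ S, ∃ k, v ∈ P S k) (hV : #V = succ θ)
    (b : (succ θ).ord.ToType → Set (succ θ).ord.ToType) :
    ∃ U : (succ θ).ord.ToType → Set V, Monotone U ∧ (∀ v, ∃ i, v ∈ U i) ∧ (∀ i, #(U i) ≤ θ) ∧
      (∀ i, X.FewNbrs κ (U i)) ∧
      ∀ i, ∀ η ≤ i, #(b η) ≤ κ → ∀ k,
        X.sparseHull κ (⋃ δ : {δ : Set.Iio i // δ.1 ∈ b η}, P (U δ.1) k) ⊆ U i := by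
  have hκθ' : κ < θ := (le_succ κ).trans_lt hκθ
  have hθ : ℵ₀ ≤ θ := hκ.trans hκθ'.le
  let I := (succ θ).ord.ToType
  have : NoMaxOrder I := Cardinal.noMaxOrder (hθ.trans (le_succ θ))
  obtain ⟨e⟩ : Nonempty (V ≃ I) := by
    rw [← Cardinal.eq]; simp [I, hV]
  have hIio : ∀ i : I, #(Set.Iio i) ≤ θ := fun i => le_of_lt_succ (mk_Iio_ord_toType_lt i)
  have hsc : ∀ W : Set V, ∃ T, #W ≤ θ → W ⊆ T ∧ #T ≤ θ ∧ X.FewNbrs κ T := fun W => by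
    by_cases hW : #W ≤ θ
    · obtain ⟨T, hT⟩ := exists_fewNbrs hκ hκθ hpow hX hι hτ hP hPS W hW
      exact ⟨T, fun _ => hT⟩
    · exact ⟨∅, fun h => absurd h hW⟩
  choose sc hsc using hsc
  -- The last union serves approachability: for |b η| ≤ κ, the k-th pieces indexed by b η have a
  -- union of size < θ, so its hull has size ≤ θ.
  let base : (i : I) → (∀ j, j < i → Set V) → Set V := fun i IH =>
    (e ⁻¹' Set.Iio i ∪ ⋃ j : Set.Iio i, IH j.1 j.2) ∪
      ⋃ p : {η : Set.Iic i // #(b η) ≤ κ} × ι,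
        X.sparseHull κ (⋃ δ : {δ : Set.Iio i // δ.1 ∈ b p.1.1}, P (IH δ.1.1 δ.1.2) p.2)
  let U : I → Set V := IsWellFounded.fix (· < ·) fun i IH => sc (base i IH)
  have hU : ∀ i, U i = sc (base i fun j _ => U j) :=
    fun i => IsWellFounded.fix_eq (· < ·) _ i
  have hbase : ∀ i, (∀ j < i, #(U j) ≤ θ) → #(base i fun j _ => U j) ≤ θ := fun i IH => by
    refine mk_union_le_of_le hθ (mk_union_le_of_le hθ ?_ ?_) ?_
    · exact (mk_preimage_of_injective _ _ e.injective).trans (hIio i)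
    · exact mk_iUnion_le_of_le hθ (hIio i) _ fun j => IH j j.2
    · refine mk_iUnion_le_of_le hθ ?_ _ fun p => mk_sparseHull_le hκ hκθ.le (hpow _ ?_)
      · rw [mk_prod, lift_id, lift_id]
        refine (mul_le_mul' ((mk_subtype_le _).trans ?_) (hι.trans hκθ'.le)).trans
          (mul_eq_self hθ).le
        obtain ⟨i', hi'⟩ := exists_gt i
        exact (mk_le_mk_of_subset fun j (hj : j ≤ i) => hj.trans_lt hi').trans (hIio i')
      · refine max_lt ?_ (hκ.trans_lt hκθ')
        refine (mk_iUnion_le_of_le (ν := max κ (τ p.2)) (hκ.trans (le_max_left _ _)) ?_ _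
          fun δ => (hP _ _).trans (le_max_right _ _)).trans_lt (max_lt hκθ' (hτ _))
        refine le_trans ?_ (p.1.2.trans (le_max_left _ _))
        exact mk_le_of_injective (f := fun δ => (⟨δ.1.1, δ.2⟩ : b p.1.1)) fun δ δ' h =>
          Subtype.ext (Subtype.ext (congrArg (fun t : b p.1.1 => t.1) h))
  have hUc : ∀ i, #(U i) ≤ θ := fun i => by
    induction i using WellFoundedLT.induction with
    | ind i IH =>
      rw [hU i]
      exact (hsc _ (hbase i IH)).2.1
  have hsub : ∀ i, (base i fun j _ => U j) ⊆ U i := fun i => by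
    conv_rhs => rw [hU i]
    exact (hsc _ (hbase i fun j _ => hUc j)).1
  refine ⟨U, fun i j hij => ?_, fun v => ?_, hUc, fun i => ?_, fun i η hη hb k => ?_⟩
  · rcases hij.eq_or_lt with rfl | h
    · exact subset_rfl
    · exact fun v hv => hsub j (Or.inl (Or.inr (Set.mem_iUnion.2 ⟨⟨i, h⟩, hv⟩)))
  · obtain ⟨i, hi⟩ := exists_gt (e v)
    exact ⟨i, hsub i (Or.inl (Or.inl hi))⟩
  · rw [hU i]
    exact (hsc _ (hbase i fun j _ => hUc j)).2.2
  · exact fun v hv => hsub i (Or.inr (Set.mem_iUnion.2 ⟨(⟨⟨η, hη⟩, hb⟩, k), hv⟩))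

end Pieces

theorem Col.of_succ_of_succ_lt (hκ : ℵ₀ ≤ κ) (hκθ : succ κ < θ) (hpow : ∀ ν < θ, ν ^ κ ≤ θ)
    (hcof : θ.ord.cof ≤ κ) (hX : X.SparseSubsets κ) (hV : #V = succ θ) (hμ : succ κ < μ)
    (hcol : ∀ s : Set V, #s < #V → (X.induce s).Col μ) : X.Col μ := by
  have hκθ' : κ < θ := (le_succ κ).trans_lt hκθ
  obtain ⟨ι, τ, P, hι, hτ, hP, hPS⟩ := exists_pieces (hκ.trans hκθ'.le) hcof V
  obtain ⟨U, hU, hcov, hUc, hUf, -⟩ := exists_chain hκ hκθ hpow hX hι hτ hP hPS hV fun _ => ∅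
  refine Col.of_cover ((hκ.trans (le_succ κ)).trans hμ.le) U hcov (fun i s hs => hcol s ?_)
    fun i v hv => ?_
  · rw [hV]
    exact lt_succ_of_le ((mk_le_mk_of_subset hs).trans (hUc i))
  · refine lt_of_le_of_lt ?_ hμ
    refine mk_le_succ_of_mk_inter_le (K := Set.Iio i) hU hκ (fun w hw => hw.1) fun k hk => ?_
    exact (mk_le_mk_of_subset (t := U k ∩ X.neighborSet v) fun w hw => ⟨hw.2, hw.1.2⟩).trans
      (hUf k v (hv k hk))

theorem Col.of_succ_of_approachable (hκ : ℵ₀ ≤ κ) (hκθ : succ κ < θ)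
    (hpow : ∀ ν < θ, ν ^ κ ≤ θ) (hcof : θ.ord.cof ≤ κ) (hX : X.SparseSubsets κ)
    (hV : #V = succ θ) (hμ : succ κ ≤ μ) (happ : Set.univ ∈ approachabilityIdeal (succ θ))
    (hcol : ∀ s : Set V, #s < #V → (X.induce s).Col μ) : X.Col μ := by
  have hκθ' : κ < θ := (le_succ κ).trans_lt hκθ
  obtain ⟨ι, τ, P, hι, hτ, hP, hPS⟩ := exists_pieces (hκ.trans hκθ'.le) hcof V
  obtain ⟨b, C, hC, -, hbC⟩ := happ
  obtain ⟨U, hU, hcov, hUc, hUf, hUb⟩ := exists_chain hκ hκθ hpow hX hι hτ hP hPS hV b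
  refine Col.of_cover ((hκ.trans (le_succ κ)).trans hμ) (fun i : C => U i.1) (fun v => ?_)
    (fun i s hs => hcol s ?_) fun i v hv => ?_
  · obtain ⟨i, hi⟩ := hcov v
    obtain ⟨j, hj, hij⟩ := hC.isCofinal i
    exact ⟨⟨j, hj⟩, hU hij hi⟩
  · rw [hV]
    exact lt_succ_of_le ((mk_le_mk_of_subset hs).trans (hUc i))
  refine lt_of_lt_of_le (lt_succ_of_le ?_) hμ
  by_contra! hN'
  obtain ⟨N, hNs, hNc⟩ := le_mk_iff_exists_subset.1 (succ_le_of_lt hN')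
  have hN : κ < #N := by rw [hNc]; exact lt_succ κ
  obtain ⟨i, hi⟩ := i
  -- `C ∩ Iio i` is cofinal below `i`
  have hKi : ∀ x < i, ∃ k ∈ C, k < i ∧ x < k := by
    by_contra! hx
    obtain ⟨x, hxi, hx⟩ := hx
    have hne : (C ∩ Set.Iio i).Nonempty := by
      obtain ⟨w, hw⟩ := mk_ne_zero_iff.1 ((zero_le (a := κ)).trans_lt hN).ne'
      obtain ⟨⟨j, hj, -⟩, -⟩ := hNs hw
      exact ⟨j.1, j.2, hj⟩
    have hwf : WellFounded ((· < ·) : (succ θ).ord.ToType → _ → Prop) := wellFounded_lt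
    have hub : (upperBounds (C ∩ Set.Iio i)).Nonempty := ⟨x, fun k hk => hx k hk.1 hk.2⟩
    let s := hwf.min _ hub
    have hs : IsLUB (C ∩ Set.Iio i) s := ⟨hwf.min_mem _ hub, fun t ht => not_lt.1 fun h =>
      hwf.not_lt_min _ ht h⟩
    have hsC : s ∈ C := hC.isLUB_mem Set.inter_subset_left hne hs
    have hsi : s < i := (hs.2 fun k hk => hx k hk.1 hk.2).trans_lt hxi
    refine hN.not_ge ((mk_le_mk_of_subset (t := U s ∩ X.neighborSet v) fun w hw => ?_).trans
      (hUf s v (hv ⟨s, hsC⟩ hsi)))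
    obtain ⟨⟨j, hj, hwj⟩, hvw⟩ := hNs hw
    exact ⟨hU (hs.1 ⟨j.2, hj⟩) hwj, hvw⟩
  -- Needed for indices outside C too, as η and the members of `c` need not lie in C.
  have hvU : ∀ k < i, v ∉ U k := fun k hk h => by
    obtain ⟨k', hk'C, hk'i, hkk'⟩ := hKi k hk
    exact hv ⟨k', hk'C⟩ hk'i (hU hkk'.le h)
  have hNK : ∀ w ∈ N, ∃ k ∈ Set.Iio i, w ∈ U k := fun w hw => by
    obtain ⟨⟨j, hj, hwj⟩, -⟩ := hNs hw
    exact ⟨j, hj, hwj⟩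
  have hNk : ∀ k ∈ Set.Iio i, #(N ∩ U k : Set V) ≤ κ := fun k hk =>
    (mk_le_mk_of_subset (t := U k ∩ X.neighborSet v) fun w hw => ⟨hw.2, (hNs hw.1).2⟩).trans
      (hUf k v (hvU k hk))
  obtain ⟨c, hci, hccof, hctype, hcb⟩ := hbC i ⟨hi, Set.mem_univ i⟩
  -- proper initial segments of `c` have size at most `κ`
  have hcofi : cof (Set.Iio i) ≤ succ κ := by
    choose f hf hfU using fun w : N => hNK w w.2
    have hcf : IsCofinal (Set.range fun w : N => (⟨f w, hf w⟩ : Set.Iio i)) := by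
      by_contra hcf
      obtain ⟨x, hx⟩ := not_isCofinal_iff.1 hcf
      refine hN.not_ge ((mk_le_mk_of_subset (t := N ∩ U x.1) fun w hw => ⟨hw, ?_⟩).trans
        (hNk x.1 x.2))
      exact hU (hx _ ⟨⟨w, hw⟩, rfl⟩).le (hfU ⟨w, hw⟩)
    exact (cof_le hcf).trans (mk_range_le.trans hNc.le)
  have hcκ : ∀ x < i, #(c ∩ Set.Iio x : Set _) ≤ κ := fun x hx => by
    obtain ⟨y, hy, hxy⟩ := hccof x hx
    have h1 := Ordinal.typein_lt_type (fun x y : c => x < y) ⟨y, hy⟩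
    rw [hctype, Cardinal.lt_ord] at h1
    have h2 : #{z : c | z < ⟨y, hy⟩} < succ κ := lt_of_lt_of_le h1 hcofi
    refine le_trans ?_ (le_of_lt_succ h2)
    exact mk_le_of_injective (f := fun z : (c ∩ Set.Iio x : Set _) =>
      (⟨⟨z.1, z.2.1⟩, lt_of_lt_of_le z.2.2 hxy⟩ : {z : c | z < ⟨y, hy⟩})) fun z z' h =>
        Subtype.ext (congrArg (fun t => t.1.1) h)
  have hd : ∀ w : N, ∃ δ ∈ c, ∃ k, w.1 ∈ P (U δ) k := fun w => by
    obtain ⟨k, hk, hwk⟩ := hNK w w.2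
    obtain ⟨δ, hδ, hkδ⟩ := hccof k hk
    exact ⟨δ, hδ, hPS _ (hUc δ) w (hU hkδ hwk)⟩
  choose d hdc p hp using hd
  -- There are only κ piece indices, so κ⁺ of the neighbors share one.
  obtain ⟨k, hk⟩ := infinite_pigeonhole_card p (succ κ) hNc.ge (hκ.trans (le_succ κ)) (by
    rw [(isRegular_succ hκ).cof_ord]
    exact lt_succ_of_le hι)
  obtain ⟨y, hy, hys⟩ := hX (Subtype.val '' (p ⁻¹' {k}))
    (by rwa [mk_image_eq Subtype.val_injective])
  have hyN : ∀ w : y, ∃ h : w.1 ∈ N, p ⟨w, h⟩ = k := fun w => by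
    obtain ⟨w', hw', h⟩ := hy w.2
    exact ⟨h ▸ w'.2, by simpa [← h] using hw'⟩
  choose hyN hyk using hyN
  obtain ⟨x, hx, hdx⟩ := exists_forall_lt_of_mk_inter_le hU hκ hNK hNk hN hys.1
    (fun w => d ⟨w, hyN w⟩) fun w => hci (hdc _)
  obtain ⟨η, hη, hbη⟩ := hcb x hx
  -- The sparse set y lies in the k-th pieces indexed by c ∩ x = b η, so stage max η x < i has
  -- absorbed v.
  refine hvU (max η x) (max_lt hη hx) (hUb _ η (le_max_left _ _) ?_ k
    (hys.subset_sparseHull (fun w hw => ?_) fun w hw => (hNs (hyN ⟨w, hw⟩)).2))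
  · rw [← hbη]
    exact hcκ x hx
  · have hlt := hdx ⟨w, hw⟩
    have hmem : d ⟨w, hyN ⟨w, hw⟩⟩ ∈ b η := by
      rw [← hbη]
      exact ⟨hdc _, hlt⟩
    refine Set.mem_iUnion.2 ⟨⟨⟨_, hlt.trans_le (le_max_right _ _)⟩, hmem⟩, ?_⟩
    have h := hp ⟨w, hyN ⟨w, hw⟩⟩
    rwa [hyk ⟨w, hw⟩] at h

/-! ### Induction on the number of vertices. -/

theorem SparseSubsets.col (gch : GCH.{u}) (hκ : ℵ₀ ≤ κ) (hμ : succ κ ≤ μ)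
    (happ : succ κ < μ ∨ ∀ ν : Cardinal.{u}, ν.IsRegular → Set.univ ∈ approachabilityIdeal ν)
    (hX : X.SparseSubsets κ) : X.Col μ := by
  suffices H : ∀ (c : Cardinal.{u}) (V : Type u) (X : SimpleGraph V), #V = c →
      X.SparseSubsets κ → X.Col μ from H _ V X rfl hX
  intro c
  induction c using WellFoundedLT.induction with
  | ind c IH =>
  rintro V X rfl hX
  rcases le_or_gt #V μ with hVμ | hVμ
  · exact Col.of_mk_le hVμ
  have hcol : ∀ s : Set V, #s < #V → (X.induce s).Col μ := fun s hs =>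
    IH _ hs _ _ rfl (hX.induce s)
  by_cases hpow : ∀ ν < #V, ν ^ κ < #V
  · exact Col.of_power_lt hκ hμ hX hVμ hpow hcol
  push Not at hpow
  obtain ⟨ν, hνV, hν⟩ := hpow
  have hsκ : ℵ₀ ≤ succ κ := hκ.trans (le_succ κ)
  -- Under GCH, ν ^ κ ≥ |V| > ν forces |V| = θ⁺ and cf θ ≤ κ; regularity of κ⁺ then gives θ ≠ κ⁺.
  let θ := max ν (succ κ)
  have hκθ : succ κ ≤ θ := le_max_right _ _
  have hθV : θ < #V := max_lt hνV (hμ.trans_lt hVμ)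
  have hθκ : #V ≤ θ ^ κ := hν.trans (power_le_power_right (le_max_left _ _))
  have hV : #V = succ θ :=
    (hθκ.trans (gch.power_le_succ (hsκ.trans hκθ) ((le_succ κ).trans hκθ))).antisymm
      (succ_le_of_lt hθV)
  have hcof : θ.ord.cof ≤ κ := by
    by_contra! h
    exact (hθκ.trans (gch.power_le_of_lt_cof hκ h)).not_gt hθV
  have hκθ' : succ κ < θ := hκθ.lt_of_ne fun h => by
    rw [← h, (isRegular_succ hκ).cof_ord] at hcof
    exact (lt_succ κ).not_ge hcof
  have hpow : ∀ ν < θ, ν ^ κ ≤ θ := fun ν hν =>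
    gch.power_le_of_lt hκ ((le_succ κ).trans_lt hκθ') hν
  rcases happ with h | h
  · exact Col.of_succ_of_succ_lt hκ hκθ' hpow hcof hX hV h hcol
  · exact Col.of_succ_of_approachable hκ hκθ' hpow hcof hX hV hμ
      (h _ (isRegular_succ (hsκ.trans hκθ))) hcol

end SimpleGraph

theorem mainTheorem1 (gch : GCH.{u}) {κ : Cardinal.{u}} (hκ : κ.IsRegular) (hκ' : ℵ₀ < κ)
    {V : Type u} (X : SimpleGraph V) (hX : X.SList κ) :
    X.Col (succ (succ κ)) ∧
      ((∀ μ : Cardinal.{u}, μ.IsRegular → Set.univ ∈ approachabilityIdeal μ) →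
        X.Col (succ κ)) := by
  have h := hX.sparseSubsets gch hκ hκ'
  exact ⟨h.col gch hκ'.le (le_succ _) (Or.inl (lt_succ _)),
    fun happ => h.col gch hκ'.le le_rfl (Or.inr happ)⟩
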